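/- A Bernstein function is a $C^\infty$ function $\varphi:(0,\infty)\to[0,\infty)$ that has a continuous extension to $[0,\infty)$ and satisfies $(-1)^k\varphi^{(k)}(x)\le 0$ for all $k\ge 1$ and $x>0$. A function $f:(0,\infty)\to\mathbb{R}$ is a complete Bernstein function if there is a Bernstein function $\varphi$ with $f(x)=x^2\int_0^\infty e^{-sx}\varphi(s)\,ds$ for all $x>0$. Theorem 3.8. Let $f$ be a complete Bernstein function, represented as $$f(x)=\tau x+b+\int_{(0,\infty)}\frac{x}{x+t}\,\sigma(dt)\qquad(x>0)$$ with constants $\tau,b\ge 0$ and a measure $\sigma$ on $(0,\infty)$ for which these integrals are finite. Then there is a distribution function $G$ (nondecreasing and right continuous on $\mathbb{R}$, $0\le G\le 1$, $\lim_{t\to\infty}G(t)=1$, $\lim_{t\to 0^-}G(t)=0$) such that $$f(x)=\frac{1}{\int_{[0,\infty)}(x+t)^{-1}\,dG(t)}-x\qquad\text{for all }x>0$$ if and only if $\tau=0$. -/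

import Mathlib

open Set Filter Topology MeasureTheory
open scoped ContDiff

/-- A Bernstein function on `(0, ∞)`: a smooth nonnegative function with a continuous extension
to `[0, ∞)`, such that `(-1) ^ k * φ⁽ᵏ⁾ ≤ 0` for all `k ≥ 1`. Only the values on `(0, ∞)` matter. -/
structure IsBernstein (φ : ℝ → ℝ) : Prop where
  contDiffOn : ContDiffOn ℝ ∞ φ (Ioi 0)
  continuous_extension : ∃ g : ℝ → ℝ, ContinuousOn g (Ici 0) ∧ EqOn g φ (Ioi 0)
  nonneg : ∀ x : ℝ, 0 < x → 0 ≤ φ x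
  deriv_sign : ∀ k : ℕ, 1 ≤ k → ∀ x : ℝ, 0 < x → (-1 : ℝ) ^ k * iteratedDeriv k φ x ≤ 0

/-- A complete Bernstein function on `(0, ∞)`: `f x = x ^ 2 * ∫₀^∞ e ^ (-s x) φ(s) ds` for some
Bernstein function `φ`. (The integral converges for every Bernstein `φ`, a concave function on
`(0, ∞)` with a finite limit at `0`.) -/
def IsCompleteBernstein (f : ℝ → ℝ) : Prop :=
  ∃ φ : ℝ → ℝ, IsBernstein φ ∧
    ∀ x : ℝ, 0 < x → f x = x ^ 2 * ∫ s in Ioi (0 : ℝ), Real.exp (-(s * x)) * φ s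

/-- `f x = τ x + b + ∫_{(0, ∞)} x / (x + t) σ(dt)` for `x > 0`, where `τ, b ≥ 0` and `σ` is a
measure on `(0, ∞)` for which these integrals are finite. -/
structure HasRepresentation (f : ℝ → ℝ) (τ b : ℝ) (σ : Measure (Ioi (0 : ℝ))) : Prop where
  tau_nonneg : 0 ≤ τ
  b_nonneg : 0 ≤ b
  integrable : ∀ x : ℝ, 0 < x → Integrable (fun t : Ioi (0 : ℝ) => x / (x + (t : ℝ))) σ
  eq : ∀ x : ℝ, 0 < x → f x = τ * x + b + ∫ t : Ioi (0 : ℝ), x / (x + (t : ℝ)) ∂σ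

/-- A distribution function on `[0, ∞)`: nondecreasing and right continuous (part of
`StieltjesFunction`), with `0 ≤ G ≤ 1`, `G(∞) = 1` and `G(0⁻) = 0`. -/
structure IsDistributionFunction (G : StieltjesFunction ℝ) : Prop where
  nonneg : ∀ t : ℝ, 0 ≤ G t
  le_one : ∀ t : ℝ, G t ≤ 1
  tendsto_one : Tendsto G atTop (𝓝 1)
  leftLim_zero : Tendsto G (𝓝[<] 0) (𝓝 0)

/-! The identity says that `1 / (f x + x)` is the Stieltjes transform of `G`. Multiplied by `x`,
such a transform tends to the total mass 1, while `f x / x → τ`; comparing limits forces `1 / (τ +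
1) = 1`, so `τ = 0`.

Conversely, if `σ` has finitely many atoms, `1 / (f x + x)` is a diagonal resolvent entry of a
positive semidefinite matrix, and the spectral theorem gives a discrete `G`. For general `σ`,
approximate by atoms and pass to a limit of probability measures on the compactified half-line,
where limits exist but mass may sit at infinity. The same asymptotics, with `τ = 0`, show that none
does. -/

/-- The diagonal entry at `o` of the resolvent of a positive semidefinite matrix is a Stieltjes
transform of a discrete probability distribution on `[0, ∞)`. -/
theorem Matrix.PosSemidef.exists_resolvent_apply_eq_sum {n : Type*} [Fintype n] [DecidableEq n]
    {A : Matrix n n ℝ} (hA : A.PosSemidef) (o : n) :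
    ∃ p l : n → ℝ, (∀ j, 0 ≤ p j) ∧ ∑ j, p j = 1 ∧ (∀ j, 0 ≤ l j) ∧
      ∀ x : ℝ, 0 < x → ∀ w : n → ℝ, x • w + A.mulVec w = Pi.single o 1 →
        w o = ∑ j, p j / (x + l j) := by
  set U := hA.1.eigenvectorBasis with hU
  have expand : ∀ v : EuclideanSpace ℝ n, v o = ∑ j, U j o * inner ℝ (U j) v := by
    intro v
    have h := U.sum_inner_mul_inner (EuclideanSpace.single o (1 : ℝ)) v
    simp only [EuclideanSpace.inner_single_left, map_one, one_mul] at h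
    exact h.symm
  refine ⟨fun j => U j o ^ 2, hA.1.eigenvalues, fun j => sq_nonneg _, ?_,
    hA.eigenvalues_nonneg, ?_⟩
  · have h := expand (EuclideanSpace.single o (1 : ℝ))
    simp only [EuclideanSpace.inner_single_right] at h
    simp at h
    rw [h]
    exact Finset.sum_congr rfl fun j _ => by ring
  · intro x hx w hw
    have h := expand (WithLp.toLp 2 w)
    simp only at h
    rw [h]
    refine Finset.sum_congr rfl fun j _ => ?_
    have hl : 0 < x + hA.1.eigenvalues j := add_pos_of_pos_of_nonneg hx (hA.eigenvalues_nonneg j)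
    have hin : inner ℝ (U j) (WithLp.toLp 2 w) = (U j).ofLp ⬝ᵥ w := by
      rw [EuclideanSpace.inner_eq_star_dotProduct, dotProduct_comm]
      simp
    have hsym : (U j).ofLp ⬝ᵥ A.mulVec w = hA.1.eigenvalues j * ((U j).ofLp ⬝ᵥ w) := by
      have hT : A.transpose = A := by
        have := hA.1.eq
        rwa [Matrix.conjTranspose_eq_transpose_of_trivial] at this
      rw [Matrix.dotProduct_mulVec, ← Matrix.mulVec_transpose, hT,
        hA.1.mulVec_eigenvectorBasis j, smul_dotProduct, smul_eq_mul]
    -- Pairing the equation with an eigenvector gives `(x + λ j) * ⟪U j, w⟫ = U j o`.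
    have h2 := congrArg (fun v => (U j).ofLp ⬝ᵥ v) hw
    simp only [dotProduct_add, dotProduct_smul, smul_eq_mul, dotProduct_single, mul_one, hsym] at h2
    rw [hin, eq_div_iff hl.ne']
    linear_combination (U j).ofLp o * h2

/-- A rational function `x + b + ∑ i, c i * x / (x + t i)` with `b, c i, t i ≥ 0` is the reciprocal
of a Stieltjes transform of a discrete probability distribution on `[0, ∞)`. -/
theorem exists_sum_div_eq_one_div {ι : Type*} [Fintype ι] [DecidableEq ι] {b : ℝ} (hb : 0 ≤ b)
    {c t : ι → ℝ} (hc : ∀ i, 0 ≤ c i) (ht : ∀ i, 0 ≤ t i) :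
    ∃ p l : Option ι → ℝ, (∀ j, 0 ≤ p j) ∧ ∑ j, p j = 1 ∧ (∀ j, 0 ≤ l j) ∧
      ∀ x : ℝ, 0 < x → 1 / (x + b + ∑ i, c i * (x / (x + t i))) = ∑ j, p j / (x + l j) := by
  -- `Bᵀ * B` is an arrowhead matrix: corner `b + ∑ c i`, border `√(c i) * √(t i)`, diagonal `t i`.
  -- The Schur complement of the corner in `x + Bᵀ * B` is `x + b + ∑ (c i - c i * t i / (x + t
  -- i))`, the required denominator.
  let B : Matrix (Option ι) (Option ι) ℝ := Matrix.of fun i j =>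
    match i, j with
    | none, none => √b
    | none, some _ => 0
    | some i, none => √(c i)
    | some i, some j => if i = j then √(t i) else 0
  obtain ⟨p, l, hp, hp1, hl, h⟩ :=
    (Matrix.posSemidef_conjTranspose_mul_self B).exists_resolvent_apply_eq_sum none
  refine ⟨p, l, hp, hp1, hl, fun x hx => ?_⟩
  set h0 := x + b + ∑ i, c i * (x / (x + t i)) with hh0
  have hx' : ∀ i, 0 < x + t i := fun i => add_pos_of_pos_of_nonneg hx (ht i)
  have h0pos : 0 < h0 := by
    have : 0 ≤ ∑ i, c i * (x / (x + t i)) :=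
      Finset.sum_nonneg fun i _ => mul_nonneg (hc i) (div_nonneg hx.le (hx' i).le)
    linarith
  -- The `none` column of the resolvent: the `some i` rows determine `w (some i)` from `w none`.
  let w : Option ι → ℝ := fun j =>
    match j with
    | none => 1 / h0
    | some i => -(√(c i) * √(t i) / (x + t i)) * (1 / h0)
  refine h x hx w ?_
  have hBw : B.mulVec w = fun j =>
      match j with
      | none => √b * (1 / h0)
      | some i => √(c i) * (x / (x + t i)) * (1 / h0) := by
    funext j
    rcases j with _ | i
    · simp [Matrix.mulVec, dotProduct, Fintype.sum_option, B, w]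
    · simp only [Matrix.mulVec, dotProduct, Fintype.sum_option, B, w, Matrix.of_apply, ite_mul,
        zero_mul, Finset.sum_ite_eq, Finset.mem_univ, if_true]
      have := hx' i
      have := Real.mul_self_sqrt (ht i)
      field_simp
      linear_combination (-√(c i)) * this
  rw [← Matrix.mulVec_mulVec, hBw]
  funext j
  rcases j with _ | i
  · simp only [Matrix.mulVec, dotProduct, Fintype.sum_option, B, w, Matrix.of_apply, Pi.add_apply,
      Pi.smul_apply, smul_eq_mul, Matrix.conjTranspose_apply, star_trivial, Pi.single_eq_same]
    have e : ∀ i, √(c i) * (√(c i) * (x / (x + t i)) * (1 / h0)) =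
        c i * (x / (x + t i)) * (1 / h0) := fun i => by
      linear_combination (x / (x + t i)) * (1 / h0) * Real.mul_self_sqrt (hc i)
    simp only [e]
    rw [← Finset.sum_mul, ← mul_assoc, Real.mul_self_sqrt hb, ← add_mul, ← add_mul, ← add_assoc,
      ← hh0]
    exact mul_one_div_cancel h0pos.ne'
  · simp only [Matrix.mulVec, dotProduct, Fintype.sum_option, B, w, Matrix.of_apply, Pi.add_apply,
      Pi.smul_apply, smul_eq_mul, Matrix.conjTranspose_apply, star_trivial, zero_mul, ite_mul,
      Finset.sum_ite_eq', Finset.mem_univ, if_true, zero_add]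
    rw [Pi.single_eq_of_ne (by simp)]
    ring

/-- The kernel `(x + s)⁻¹` in the variable `u = 1 / (1 + s)`, which extends continuously
to `s = ∞`. -/
noncomputable def stieltjesKernel (x : ℝ) (u : unitInterval) : ℝ :=
  (u : ℝ) / (1 - (u : ℝ) + x * u)

theorem stieltjesKernel_denom_pos {x : ℝ} (hx : 0 < x) (u : unitInterval) :
    0 < 1 - (u : ℝ) + x * u := by
  have h0 := u.2.1
  have h1 := u.2.2
  rcases h1.lt_or_eq with h | h
  · have := mul_nonneg hx.le h0
    linarith
  · rw [h]; linarith

theorem continuous_stieltjesKernel {x : ℝ} (hx : 0 < x) : Continuous (stieltjesKernel x) := by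
  unfold stieltjesKernel
  exact Continuous.div (by fun_prop) (by fun_prop) fun u => (stieltjesKernel_denom_pos hx u).ne'

/-- The reciprocal of `x + b + ∑ i, c i * x / (x + t i)` as an integral over the compactified
half-line. -/
theorem exists_probabilityMeasure_one_div_sum_eq {ι : Type*} [Fintype ι] [DecidableEq ι] {b : ℝ}
    (hb : 0 ≤ b) {c t : ι → ℝ} (hc : ∀ i, 0 ≤ c i) (ht : ∀ i, 0 ≤ t i) :
    ∃ μ : ProbabilityMeasure unitInterval, ∀ x : ℝ, 0 < x →
      1 / (x + b + ∑ i, c i * (x / (x + t i))) =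
        ∫ u, stieltjesKernel x u ∂(μ : Measure unitInterval) := by
  obtain ⟨p, l, hp, hp1, hl, h⟩ := exists_sum_div_eq_one_div hb hc ht
  have hmem : ∀ j, 1 / (1 + l j) ∈ unitInterval := fun j =>
    ⟨div_nonneg zero_le_one (by linarith [hl j]),
      (div_le_one (by linarith [hl j])).2 (by linarith [hl j])⟩
  let μ : Measure unitInterval :=
    ∑ j, ENNReal.ofReal (p j) • Measure.dirac ⟨1 / (1 + l j), hmem j⟩
  have hμ : IsProbabilityMeasure μ := by
    constructor
    simp only [μ, Measure.finsetSum_apply, Measure.smul_apply, measure_univ, smul_eq_mul, mul_one]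
    rw [← ENNReal.ofReal_sum_of_nonneg fun j _ => hp j, hp1, ENNReal.ofReal_one]
  refine ⟨⟨μ, hμ⟩, fun x hx => ?_⟩
  rw [h x hx]
  change _ = ∫ u, stieltjesKernel x u ∂μ
  have hi : ∀ ν : Measure unitInterval, IsFiniteMeasure ν → Integrable (stieltjesKernel x) ν :=
    fun ν _ => (continuous_stieltjesKernel hx).integrable_of_hasCompactSupport
      (HasCompactSupport.of_compactSpace _)
  rw [integral_finsetSum_measure fun j _ => (hi _ inferInstance).smul_measure ENNReal.ofReal_ne_top]
  refine Finset.sum_congr rfl fun j _ => ?_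
  rw [integral_smul_measure, integral_dirac, ENNReal.toReal_ofReal (hp j), smul_eq_mul,
    stieltjesKernel]
  have h1 : 0 < 1 + l j := by linarith [hl j]
  have h2 : 0 < x + l j := by linarith [hl j]
  have h3 : 1 - 1 / (1 + l j) + x * (1 / (1 + l j)) = (x + l j) / (1 + l j) := by
    field_simp; ring
  simp only [h3]
  field_simp

theorem MeasureTheory.SimpleFunc.integral_comp_eq_sum {α β : Type*} [MeasurableSpace α]
    (μ : Measure α) [IsFiniteMeasure μ] (s : SimpleFunc α β) (g : β → ℝ) :
    ∫ a, g (s a) ∂μ = ∑ y : {y // y ∈ s.range}, μ.real (s ⁻¹' {(y : β)}) * g y := by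
  classical
  have h : ∀ a, g (s a) =
      ∑ y : {y // y ∈ s.range}, (s ⁻¹' {(y : β)}).indicator (fun _ => g y) a := fun a => by
    rw [Finset.sum_eq_single ⟨s a, s.mem_range_self a⟩]
    · simp
    · intro y _ hy
      refine indicator_of_notMem (fun hm => hy ?_) _
      exact Subtype.ext (by simpa using hm.symm)
    · simp
  rw [integral_congr_ae (Eventually.of_forall h),
    integral_finsetSum _ fun (y : {y // y ∈ s.range}) _ =>
      (integrable_const (g y)).indicator (s.measurableSet_preimage {(y : β)})]
  refine Finset.sum_congr rfl fun y _ => ?_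
  rw [integral_indicator_const _ (s.measurableSet_preimage {(y : β)}), smul_eq_mul]

/-- The reciprocal of `x + b + ∫ x / (x + t) σ(dt)` is an integral of the compactified Stieltjes
kernel against a probability measure. -/
theorem exists_probabilityMeasure_one_div_eq {b : ℝ} (hb : 0 ≤ b) {σ : Measure (Ioi (0 : ℝ))}
    (hσ : ∀ x : ℝ, 0 < x → Integrable (fun t : Ioi (0 : ℝ) => x / (x + (t : ℝ))) σ) :
    ∃ μ : ProbabilityMeasure unitInterval, ∀ x : ℝ, 0 < x →
      1 / (x + b + ∫ t : Ioi (0 : ℝ), x / (x + (t : ℝ)) ∂σ) =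
        ∫ u, stieltjesKernel x u ∂(μ : Measure unitInterval) := by
  classical
  -- `σ` may be infinite, but integrability at `x = 1` makes `ν = d σ` finite. Dividing the
  -- integrand by `d` gives `k x`, which is bounded and continuous.
  let d : Ioi (0 : ℝ) → ℝ := fun t => 1 / (1 + (t : ℝ))
  let ν : Measure (Ioi (0 : ℝ)) := σ.withDensity fun t => ENNReal.ofReal (d t)
  have hν : IsFiniteMeasure ν := isFiniteMeasure_withDensity_ofReal (hσ 1 one_pos).2
  have hdm : Measurable fun t => ENNReal.ofReal (d t) := by
    refine Measurable.ennreal_ofReal ?_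
    exact measurable_const.div (measurable_const.add measurable_subtype_coe)
  let k : ℝ → Ioi (0 : ℝ) → ℝ := fun x t => (1 + (t : ℝ)) * (x / (x + t))
  have hpos : ∀ {x : ℝ}, 0 < x → ∀ t : Ioi (0 : ℝ), 0 < x + (t : ℝ) := fun hx t =>
    add_pos hx t.2
  have hk_cont : ∀ {x : ℝ}, 0 < x → Continuous (k x) := fun hx =>
    (by fun_prop : Continuous fun t : Ioi (0 : ℝ) => 1 + (t : ℝ)).mul
      (Continuous.div (by fun_prop) (by fun_prop) fun t => (hpos hx t).ne')
  have hk_bound : ∀ {x : ℝ}, 0 < x → ∀ t, ‖k x t‖ ≤ 1 + x := by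
    intro x hx t
    have ht : (0 : ℝ) < t := t.2
    have h1 : 0 ≤ k x t := mul_nonneg (by linarith) (div_nonneg hx.le (hpos hx t).le)
    rw [Real.norm_of_nonneg h1]
    change (1 + (t : ℝ)) * (x / (x + t)) ≤ 1 + x
    rw [← mul_div_assoc, div_le_iff₀ (hpos hx t)]
    nlinarith [mul_pos hx hx]
  have hk_int : ∀ {x : ℝ}, 0 < x → ∫ t, k x t ∂ν = ∫ t : Ioi (0 : ℝ), x / (x + (t : ℝ)) ∂σ := by
    intro x hx
    rw [integral_withDensity_eq_integral_toReal_smul hdm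
      (Eventually.of_forall fun _ => ENNReal.ofReal_lt_top)]
    refine integral_congr_ae (Eventually.of_forall fun t => ?_)
    have ht : (0 : ℝ) < 1 + t := hpos one_pos t
    simp only [d, k]
    rw [ENNReal.toReal_ofReal (by positivity), smul_eq_mul, ← mul_assoc,
      one_div_mul_cancel ht.ne', one_mul]
  -- Rounding the point `t`, rather than the integrand, replaces `ν` by a finitely supported measure
  -- that serves every `x` at once.
  let s : ℕ → SimpleFunc (Ioi (0 : ℝ)) (Ioi (0 : ℝ)) := fun n =>
    SimpleFunc.approxOn id measurable_id univ ⟨1, mem_Ioi.2 one_pos⟩ (mem_univ _) n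
  have hs : ∀ t, Tendsto (fun n => s n t) atTop (𝓝 t) := fun t =>
    SimpleFunc.tendsto_approxOn measurable_id (mem_univ _) (by simp)
  have happrox : ∀ n, ∃ μ : ProbabilityMeasure unitInterval, ∀ x : ℝ, 0 < x →
      1 / (x + b + ∫ t, k x (s n t) ∂ν) =
        ∫ u, stieltjesKernel x u ∂(μ : Measure unitInterval) := by
    intro n
    obtain ⟨μ, hμ⟩ := exists_probabilityMeasure_one_div_sum_eq hb
      (c := fun y : {y // y ∈ (s n).range} => ν.real (s n ⁻¹' {y.1}) * (1 + (y.1 : ℝ)))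
      (t := fun y => (y.1 : ℝ))
      (fun y => mul_nonneg measureReal_nonneg (hpos one_pos y.1).le) (fun y => le_of_lt y.1.2)
    refine ⟨μ, fun x hx => ?_⟩
    rw [← hμ x hx, SimpleFunc.integral_comp_eq_sum]
    simp only [k, mul_assoc]
  choose μ hμ using happrox
  -- Compactness along an ultrafilter gives one weak limit valid for all `x`.
  obtain ⟨μ', -, hμ'⟩ := isCompact_iff_ultrafilter_le_nhds.1
    (isCompact_univ (X := ProbabilityMeasure unitInterval))
    (Ultrafilter.map μ (hyperfilter ℕ)) (by simp)
  refine ⟨μ', fun x hx => ?_⟩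
  have hle : ((hyperfilter ℕ : Ultrafilter ℕ) : Filter ℕ) ≤ atTop := by
    rw [← Nat.cofinite_eq_atTop]; exact hyperfilter_le_cofinite
  have hμt : Tendsto μ (hyperfilter ℕ : Filter ℕ) (𝓝 μ') := hμ'
  have h1 : Tendsto (fun n => ∫ u, stieltjesKernel x u ∂(μ n : Measure unitInterval))
      (hyperfilter ℕ : Filter ℕ) (𝓝 (∫ u, stieltjesKernel x u ∂(μ' : Measure unitInterval))) :=
    ProbabilityMeasure.tendsto_iff_forall_integral_tendsto.1 hμt
      (BoundedContinuousFunction.mkOfCompact ⟨_, continuous_stieltjesKernel hx⟩)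
  have h2 : Tendsto (fun n => ∫ t, k x (s n t) ∂ν) atTop
      (𝓝 (∫ t : Ioi (0 : ℝ), x / (x + (t : ℝ)) ∂σ)) := by
    rw [← hk_int hx]
    refine tendsto_integral_of_dominated_convergence (fun _ => 1 + x) (fun n => ?_)
      (integrable_const _) (fun n => Eventually.of_forall fun t => hk_bound hx _)
      (Eventually.of_forall fun t => ((hk_cont hx).tendsto t).comp (hs t))
    exact ((hk_cont hx).measurable.comp (s n).measurable).aestronglyMeasurable
  have hI : 0 ≤ ∫ t : Ioi (0 : ℝ), x / (x + (t : ℝ)) ∂σ :=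
    integral_nonneg fun t => div_nonneg hx.le (hpos hx t).le
  have h3 : Tendsto (fun n => 1 / (x + b + ∫ t, k x (s n t) ∂ν)) (hyperfilter ℕ : Filter ℕ)
      (𝓝 (1 / (x + b + ∫ t : Ioi (0 : ℝ), x / (x + (t : ℝ)) ∂σ))) :=
    (tendsto_const_nhds.div (tendsto_const_nhds.add h2)
      (by linarith : x + b + ∫ t : Ioi (0 : ℝ), x / (x + (t : ℝ)) ∂σ ≠ 0)).mono_left hle
  simp only [fun n => hμ n x hx] at h3
  exact tendsto_nhds_unique h3 h1

/-- `τ x + b + ∫ x / (x + t) σ(dt)` grows like `τ x`. -/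
theorem HasRepresentation.tendsto_div_atTop {f : ℝ → ℝ} {τ b : ℝ} {σ : Measure (Ioi (0 : ℝ))}
    (h : HasRepresentation f τ b σ) : Tendsto (fun x => f x / x) atTop (𝓝 τ) := by
  have hpos : ∀ {x : ℝ}, 0 < x → ∀ t : Ioi (0 : ℝ), 0 < x + (t : ℝ) := fun hx t =>
    add_pos hx t.2
  have h1 : Tendsto (fun x : ℝ => ∫ t : Ioi (0 : ℝ), 1 / (x + (t : ℝ)) ∂σ) atTop (𝓝 0) := by
    suffices Tendsto (fun x : ℝ => ∫ t : Ioi (0 : ℝ), 1 / (x + (t : ℝ)) ∂σ) atTop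
        (𝓝 (∫ _, (0 : ℝ) ∂σ)) by simpa only [integral_zero] using this
    refine tendsto_integral_filter_of_dominated_convergence (fun t => 1 / (1 + (t : ℝ))) ?_ ?_
      (h.integrable 1 one_pos) (Eventually.of_forall fun t => ?_)
    · refine Eventually.of_forall fun x => Measurable.aestronglyMeasurable ?_
      exact measurable_const.div (measurable_const.add measurable_subtype_coe)
    · filter_upwards [eventually_ge_atTop 1] with x hx
      refine Eventually.of_forall fun t => ?_
      rw [Real.norm_of_nonneg (div_nonneg zero_le_one (hpos (by linarith) t).le)]
      exact one_div_le_one_div_of_le (hpos one_pos t) (by linarith)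
    · exact tendsto_const_nhds.div_atTop (tendsto_atTop_add_const_right _ _ tendsto_id)
  have h2 : Tendsto (fun x : ℝ => τ + b / x + ∫ t : Ioi (0 : ℝ), 1 / (x + (t : ℝ)) ∂σ) atTop
      (𝓝 (τ + 0 + 0)) :=
    (tendsto_const_nhds.add (tendsto_const_nhds.div_atTop tendsto_id)).add h1
  rw [add_zero, add_zero] at h2
  refine h2.congr' ?_
  filter_upwards [eventually_gt_atTop 0] with x hx
  have h3 : ∫ t : Ioi (0 : ℝ), x / (x + (t : ℝ)) ∂σ =
      x * ∫ t : Ioi (0 : ℝ), 1 / (x + (t : ℝ)) ∂σ := by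
    rw [← integral_const_mul]
    simp only [mul_one_div]
  rw [h.eq x hx, h3]
  field_simp

theorem IsDistributionFunction.measure_Ici_zero {G : StieltjesFunction ℝ}
    (hG : IsDistributionFunction G) : G.measure (Ici 0) = 1 := by
  rw [G.measure_Ici hG.tendsto_one, leftLim_eq_of_tendsto
    hG.leftLim_zero, sub_zero, ENNReal.ofReal_one]

theorem IsDistributionFunction.tendsto_mul_integral_inv_add {G : StieltjesFunction ℝ}
    (hG : IsDistributionFunction G) :
    Tendsto (fun x : ℝ => x * ∫ t in Ici (0 : ℝ), (x + t)⁻¹ ∂G.measure) atTop (𝓝 1) := by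
  have hprob : IsProbabilityMeasure (G.measure.restrict (Ici 0)) :=
    ⟨by rw [Measure.restrict_apply_univ, hG.measure_Ici_zero]⟩
  have h : Tendsto (fun x : ℝ => ∫ t in Ici (0 : ℝ), x * (x + t)⁻¹ ∂G.measure) atTop
      (𝓝 (∫ _ in Ici (0 : ℝ), (1 : ℝ) ∂G.measure)) := by
    refine tendsto_integral_filter_of_dominated_convergence (fun _ => 1) ?_ ?_
      (integrable_const _) (Eventually.of_forall fun t => ?_)
    · exact Eventually.of_forall fun x => Measurable.aestronglyMeasurable (by fun_prop)
    · filter_upwards [eventually_gt_atTop 0] with x hx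
      filter_upwards [ae_restrict_mem measurableSet_Ici] with t ht
      have ht' : 0 ≤ t := ht
      rw [Real.norm_of_nonneg (by positivity), ← div_eq_mul_inv, div_le_one (by linarith)]
      linarith
    · have h1 : Tendsto (fun x : ℝ => 1 - t / (x + t)) atTop (𝓝 (1 - 0)) :=
        tendsto_const_nhds.sub (tendsto_const_nhds.div_atTop
          (tendsto_atTop_add_const_right _ _ tendsto_id))
      rw [sub_zero] at h1
      refine h1.congr' ?_
      filter_upwards [eventually_gt_atTop (-t)] with x hx
      have : x + t ≠ 0 := by linarith
      field_simp
      ring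
  simpa [integral_const_mul] using h

/-- `x * stieltjesKernel x u` tends to 1 for `u ≠ 0` but vanishes at `u = 0`, the point at infinity,
so the limit measures the mass that has not escaped. -/
theorem tendsto_integral_mul_stieltjesKernel (μ : Measure unitInterval) [IsFiniteMeasure μ] :
    Tendsto (fun x : ℝ => x * ∫ u, stieltjesKernel x u ∂μ) atTop (𝓝 (μ.real {0}ᶜ)) := by
  have h : Tendsto (fun x : ℝ => ∫ u, x * stieltjesKernel x u ∂μ) atTop
      (𝓝 (∫ u, ({0}ᶜ : Set unitInterval).indicator 1 u ∂μ)) := by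
    refine tendsto_integral_filter_of_dominated_convergence (fun _ => 1) ?_ ?_
      (integrable_const _) (Eventually.of_forall fun u => ?_)
    · filter_upwards [eventually_gt_atTop 0] with x hx
      exact (continuous_const.mul (continuous_stieltjesKernel hx)).aestronglyMeasurable
    · filter_upwards [eventually_gt_atTop 0] with x hx
      refine Eventually.of_forall fun u => ?_
      have h0 := stieltjesKernel_denom_pos hx u
      have h1 := u.2.1
      have h2 := u.2.2
      rw [stieltjesKernel, ← mul_div_assoc, Real.norm_of_nonneg (by positivity), div_le_one h0]
      linarith
    · by_cases hu : u = 0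
      · simp [hu, stieltjesKernel]
      · have hu0 : 0 < (u : ℝ) := unitInterval.pos_iff_ne_zero.2 hu
        have h1 : Tendsto (fun x : ℝ => 1 - (1 - (u : ℝ)) / (1 - (u : ℝ) + x * u)) atTop
            (𝓝 (1 - 0)) :=
          tendsto_const_nhds.sub (tendsto_const_nhds.div_atTop
            (tendsto_atTop_add_const_left _ _ (tendsto_id.atTop_mul_const hu0)))
        have hu' : u ∈ ({0}ᶜ : Set unitInterval) := hu
        rw [indicator_of_mem hu', Pi.one_apply]
        rw [sub_zero] at h1
        refine h1.congr' ?_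
        filter_upwards [eventually_gt_atTop 0] with x hx
        have h0 := stieltjesKernel_denom_pos hx u
        rw [stieltjesKernel, one_sub_div h0.ne', ← mul_div_assoc]
        congr 1
        ring
  rw [integral_indicator_one (measurableSet_singleton 0).compl] at h
  simpa only [integral_const_mul] using h

/-- A probability measure on the compactified half-line without mass at infinity comes from
a distribution function. -/
theorem exists_isDistributionFunction_integral_eq (μ : Measure unitInterval)
    [IsProbabilityMeasure μ] (hμ : μ {0} = 0) :
    ∃ G : StieltjesFunction ℝ, IsDistributionFunction G ∧ ∀ x : ℝ, 0 < x →
      ∫ t in Ici (0 : ℝ), (x + t)⁻¹ ∂G.measure = ∫ u, stieltjesKernel x u ∂μ := by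
  -- The inverse of `u = 1 / (1 + s)`. Its default value at `u = 0` is `-1`, outside `[0, ∞)`, which
  -- is harmless because `{0}` is null.
  let g : unitInterval → ℝ := fun u => 1 / (u : ℝ) - 1
  have hg : Measurable g := (measurable_const.div measurable_subtype_coe).sub_const 1
  have hne : ∀ᵐ u ∂μ, u ≠ 0 := measure_eq_zero_iff_ae_notMem.1 hμ
  have hP : IsProbabilityMeasure (μ.map g) := Measure.isProbabilityMeasure_map hg.aemeasurable
  have hmem : ∀ᵐ t ∂(μ.map g), t ∈ Ici (0 : ℝ) := by
    refine (ae_map_iff hg.aemeasurable measurableSet_Ici).2 ?_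
    filter_upwards [hne] with u hu
    have hu0 : 0 < (u : ℝ) := unitInterval.pos_iff_ne_zero.2 hu
    exact sub_nonneg.2 ((one_le_div hu0).2 u.2.2)
  refine ⟨ProbabilityTheory.cdf (μ.map g), ⟨ProbabilityTheory.cdf_nonneg _,
    ProbabilityTheory.cdf_le_one _, ProbabilityTheory.tendsto_cdf_atTop _, ?_⟩, fun x hx => ?_⟩
  · refine tendsto_const_nhds.congr' ?_
    filter_upwards [self_mem_nhdsWithin] with t ht
    rw [ProbabilityTheory.cdf_eq_real, measureReal_def, measure_eq_zero_iff_ae_notMem.2,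
      ENNReal.toReal_zero]
    filter_upwards [hmem] with s hs hst
    exact absurd (lt_of_le_of_lt hst ht) (not_lt.2 (mem_Ici.1 hs))
  · rw [ProbabilityTheory.measure_cdf, Measure.restrict_eq_self_of_ae_mem hmem,
      integral_map hg.aemeasurable (Measurable.aestronglyMeasurable (by fun_prop))]
    refine integral_congr_ae ?_
    filter_upwards [hne] with u hu
    have hu0 : 0 < (u : ℝ) := unitInterval.pos_iff_ne_zero.2 hu
    have h0 := stieltjesKernel_denom_pos hx u
    have h1 : x + g u = (1 - (u : ℝ) + x * u) / u := by
      simp only [g]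
      field_simp
      ring
    rw [h1, inv_div, stieltjesKernel]

theorem theorem3p8 (f : ℝ → ℝ) (hf : IsCompleteBernstein f)
    (τ b : ℝ) (σ : Measure (Ioi (0 : ℝ))) (hrep : HasRepresentation f τ b σ) :
    (∃ G : StieltjesFunction ℝ, IsDistributionFunction G ∧
      ∀ x : ℝ, 0 < x → f x = 1 / (∫ t in Ici (0 : ℝ), (x + t)⁻¹ ∂G.measure) - x) ↔ τ = 0 := by
  have hlim : Tendsto (fun x => f x / x + 1) atTop (𝓝 (τ + 1)) :=
    hrep.tendsto_div_atTop.add_const 1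
  constructor
  · rintro ⟨G, hG, h⟩
    have h1 : Tendsto (fun x => f x / x + 1) atTop (𝓝 1⁻¹) := by
      refine (hG.tendsto_mul_integral_inv_add.inv₀ one_ne_zero).congr' ?_
      filter_upwards [eventually_gt_atTop 0] with x hx
      rw [h x hx, mul_inv]
      field_simp
      ring
    have := tendsto_nhds_unique hlim h1
    rw [inv_one] at this
    linarith
  · rintro rfl
    obtain ⟨μ, hμ⟩ := exists_probabilityMeasure_one_div_eq hrep.b_nonneg hrep.integrable
    have hμ' : ∀ x : ℝ, 0 < x →
        1 / (f x + x) = ∫ u, stieltjesKernel x u ∂(μ : Measure unitInterval) := fun x hx => by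
      rw [← hμ x hx, hrep.eq x hx]
      congr 1
      ring
    have h1 : Tendsto (fun x => x * ∫ u, stieltjesKernel x u ∂(μ : Measure unitInterval)) atTop
        (𝓝 1) := by
      have h2 := hlim.inv₀ (by norm_num)
      rw [zero_add, inv_one] at h2
      refine h2.congr' ?_
      filter_upwards [eventually_gt_atTop 0] with x hx
      rw [← hμ' x hx, div_add_one hx.ne', inv_div, mul_one_div]
    have h2 : (μ : Measure unitInterval).real {0}ᶜ = 1 :=
      tendsto_nhds_unique (tendsto_integral_mul_stieltjesKernel _) h1
    have h3 : (μ : Measure unitInterval) {0} = 0 := by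
      rw [probReal_compl_eq_one_sub (measurableSet_singleton 0)] at h2
      exact (measureReal_eq_zero_iff (measure_ne_top _ _)).1 (by linarith)
    obtain ⟨G, hG, hGμ⟩ := exists_isDistributionFunction_integral_eq _ h3
    refine ⟨G, hG, fun x hx => ?_⟩
    rw [hGμ x hx, ← hμ' x hx, one_div_one_div]
    ring
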